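/- Let a finite multigraph $\Gamma$ (loops and parallel edges allowed) with vertex set $V$ and edge set $E\neq\emptyset$ be given, and turn it into a metric graph $G$ by identifying each edge $e$ with $[0,1]$, running from a vertex $e(0)$ to a vertex $e(1)$. Let $\Delta^{CK}$ be the operator $u=(u_e)_{e\in E}\mapsto (u_e'')_{e\in E}$ on $L^2(0,1;\mathbb C^E)$ whose domain consists of all $u\in H^2(0,1;\mathbb C^E)$ that are continuous in the vertices (there is $\varphi:V\to\mathbb C$ with $u_e(0)=\varphi(e(0))$ and $u_e(1)=\varphi(e(1))$ for all $e$) and satisfy the Kirchhoff condition $\sum_{e:\,e(1)=v}u_e'(1)-\sum_{e:\,e(0)=v}u_e'(0)=0$ at every vertex $v$. Say that $\Gamma_2$ is formed from $\Gamma_1$ by contractions of vertices if $\Gamma_2$ arises by identifying vertices of $\Gamma_1$ and keeping the edges (up to reversing their parametrization), edges that become parallel remaining distinct; an edge joining two distinct vertices that are identified becomes a loop, which may be either retained or discarded. **Proposition.** Let $\Gamma_1,\Gamma_2$ be connected finite multigraphs such that $\Gamma_2$ is formed from $\Gamma_1$ by contractions of vertices and has at least one edge. Then $-\Delta^{CK}$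 on the metric graph $G_i$ of $\Gamma_i$ has a lowest nontrivial (i.e. nonzero) eigenvalue $\lambda^{(i)}$ $(i=1,2)$, and $$0<\lambda^{(1)}\le\lambda^{(2)}.$$ Consequently, the heat equation under $CK$-conditions on $G_2$ converges to equilibrium at least as fast as the one on $G_1$. Precisely, say that the heat equation on $G$ converges at rate $\alpha\in\mathbb R$ if there is a constant $C$ such that $$\|u(t)-\bar u\|\le C e^{-\alpha t}\,\|u(0)-\bar u\|\qquad(t\ge0)$$ in $L^2(0,1;\mathbb C^E)$ for every continuous $u:[0,\infty)\to L^2(0,1;\mathbb C^E)$ that is differentiable on $(0,\infty)$ with $u(t)\in D(\Delta^{CK})$ and $u'(t)=\Delta^{CK}u(t)$ for $t>0$, where the equilibrium $\bar u$ is the constant function on $G$ whose value is the mean $\frac1{\# E}\sum_{e\in E}\int_0^1u_e(0)(x)\,dx$ of the initial value $u(0)=(u_e(0))_{e\in E}$. Then $\lambda^{(i)}$ is the greatest rate at which the heat equation on $G_i$ converges $(i=1,2)$, and every rate of convergence on $G_1$ is also a rate of convergence on $G_2$. -/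

import Mathlib

open MeasureTheory Set

noncomputable section

namespace CKHeat

/-- A multigraph (parallel edges and loops allowed) with vertex set `V` and edge set `E`. Each
edge `e` is identified with the unit interval `[0,1]`, running from `src e` (at `0`) to `tgt e`
(at `1`); this choice of a parametrization turns the graph into a metric graph. -/
structure Multigraph (V E : Type*) where
  src : E → V
  tgt : E → V

/-- Connectedness: `V` is nonempty and any two vertices are joined by a path (edges may be
traversed in both directions; loops are irrelevant). -/
def Multigraph.Connected {V E : Type*} (Γ : Multigraph V E) : Prop :=
  (SimpleGraph.fromRel (fun a b : V => ∃ e, Γ.src e = a ∧ Γ.tgt e = b)).Connected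

/-- `Γ₂` is formed from `Γ₁` by contractions of vertices: vertices of `Γ₁` are identified with each
other (through the surjection `p`, two vertices being identified when they have the same image),
and the edges are kept (through `i`, up to a reversal of the parametrization of an edge). In
particular edges that become parallel stay distinct. An edge joining two distinct vertices that are
identified becomes a loop, which may either be retained or be discarded. -/
def Multigraph.IsVertexContraction {V₁ E₁ V₂ E₂ : Type*}
    (Γ₁ : Multigraph V₁ E₁) (Γ₂ : Multigraph V₂ E₂) : Prop :=
  ∃ (p : V₁ → V₂) (i : E₂ → E₁), Function.Surjective p ∧ Function.Injective i ∧
    (∀ e : E₂,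
      (Γ₂.src e = p (Γ₁.src (i e)) ∧ Γ₂.tgt e = p (Γ₁.tgt (i e))) ∨
      (Γ₂.src e = p (Γ₁.tgt (i e)) ∧ Γ₂.tgt e = p (Γ₁.src (i e)))) ∧
    (∀ e : E₁, e ∉ Set.range i →
      Γ₁.src e ≠ Γ₁.tgt e ∧ p (Γ₁.src e) = p (Γ₁.tgt e))

/-- The Hilbert space `L²(0,1; ℂ^E)` of square integrable functions on the metric graph. -/
abbrev L2 (E : Type*) [Fintype E] : Type _ :=
  Lp (EuclideanSpace ℂ E) 2 (volume.restrict (Icc (0 : ℝ) 1))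

variable {V E : Type*} [Fintype E]

open Classical in
/-- The graph of the operator `Δ^CK`: `f` lies in the domain of `Δ^CK`, and `Δ^CK f = g`. That is,
`f` has a representative `F` in `H²(0,1; ℂ^E)` (so `F` is an antiderivative of `F'`, and `F'` one
of `g ∈ L²`, on `[0,1]`) which is continuous in the vertices (with vertex values `φ`) and satisfies
the Kirchhoff condition: at each vertex the outer normal derivatives sum up to zero. -/
def Multigraph.IsCKLaplacian (Γ : Multigraph V E) (f g : L2 E) : Prop :=
  ∃ F F' : ℝ → EuclideanSpace ℂ E,
    (f : ℝ → EuclideanSpace ℂ E) =ᵐ[volume.restrict (Icc (0 : ℝ) 1)] F ∧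
    (∀ x ∈ Icc (0 : ℝ) 1, F x = F 0 + ∫ s in (0 : ℝ)..x, F' s) ∧
    (∀ x ∈ Icc (0 : ℝ) 1, F' x = F' 0 + ∫ s in (0 : ℝ)..x, g s) ∧
    (∃ φ : V → ℂ, ∀ e : E, F 0 e = φ (Γ.src e) ∧ F 1 e = φ (Γ.tgt e)) ∧
    (∀ v : V, ∑ e : E,
      ((if Γ.tgt e = v then F' 1 e else 0) - (if Γ.src e = v then F' 0 e else 0)) = 0)

/-- `lam` is an eigenvalue of `-Δ^CK`. -/
def Multigraph.IsCKEigenvalue (Γ : Multigraph V E) (lam : ℝ) : Prop :=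
  ∃ f : L2 E, f ≠ 0 ∧ Γ.IsCKLaplacian f (-((lam : ℂ) • f))

/-- `lam` is the lowest nontrivial (i.e. nonzero) eigenvalue of `-Δ^CK`. -/
def Multigraph.IsLowestNontrivialCKEigenvalue (Γ : Multigraph V E) (lam : ℝ) : Prop :=
  IsLeast {l : ℝ | l ≠ 0 ∧ Γ.IsCKEigenvalue l} lam

/-- `u` solves the heat equation `u' = Δ^CK u` on `(0,∞)`, in the sense of the abstract Cauchy
problem in `L²(0,1; ℂ^E)`, with an arbitrary initial value `u 0` in this space. -/
def Multigraph.IsCKHeatSolution (Γ : Multigraph V E) (u : ℝ → L2 E) : Prop :=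
  ContinuousOn u (Ici 0) ∧
    ∀ t : ℝ, 0 < t → ∃ g : L2 E, HasDerivAt u g t ∧ Γ.IsCKLaplacian (u t) g

/-- The equilibrium that belongs to the initial value `f` on a connected metric graph: the constant
function on the metric graph whose value is the mean value of `f`. -/
def equilibrium (f : L2 E) : L2 E :=
  Lp.const 2 (volume.restrict (Icc (0 : ℝ) 1))
    (WithLp.toLp 2 (fun _ : E =>
      (Fintype.card E : ℂ)⁻¹ * ∑ e : E, ∫ x in (0 : ℝ)..1, (f : ℝ → EuclideanSpace ℂ E) x e))

/-- The solutions of the heat equation under the `CK`-condition converge to their equilibria at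
least at the exponential rate `α`, uniformly in the initial value. -/
def Multigraph.HeatConvergesAtRate (Γ : Multigraph V E) (α : ℝ) : Prop :=
  ∃ C : ℝ, ∀ u : ℝ → L2 E, Γ.IsCKHeatSolution u → ∀ t : ℝ, 0 ≤ t →
    ‖u t - equilibrium (u 0)‖ ≤ C * Real.exp (-α * t) * ‖u 0 - equilibrium (u 0)‖

end CKHeat

end

/-! The operator $-\Delta^{CK}$ belongs to the form $\|u'\|^2$ on the $H^1$ functions that are
continuous in the vertices. Continuity is the only constraint on the form domain; the Kirchhoff
condition is the natural boundary condition. Integration by parts gives the weak equation, and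
`isCKLaplacian_of_weak` recovers the strong one.

On a connected graph a derivative $k'$ determines $k$ up to a constant, so $k' \mapsto k - \bar k$
extends by an orthogonal projection to an operator $A$ on $L^2$, compact by Arzelà–Ascoli. Its norm
gives the best Poincaré constant $\lambda = \|A\|^{-2}$, and an eigenvector of $AA^\dagger$ for
$\|A\|^2$ is an eigenfunction for $\lambda$ (`Connected.exists_spectralGap`). Thus $\lambda$ is the
lowest nonzero eigenvalue. An energy estimate makes it a rate of convergence, and the solution
$e^{-\lambda t}f$ shows that no greater rate is possible.

Identifying vertices only adds continuity constraints: an eigenfunction on $G_2$ pulls back to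
$G_1$, constant on discarded edges, with the same energy and with no smaller distance from the
constants. Hence $\lambda^{(1)} \le \lambda^{(2)}$ (`IsVertexContraction.gap_le`). -/

noncomputable section

namespace CKHeat

open scoped InnerProductSpace InnerProduct

/-! ### Integration by parts for vector-valued absolutely continuous functions. -/

section ByParts

theorem continuousOn_of_eq_primitive {X : Type*} [NormedAddCommGroup X]
    [NormedSpace ℝ X] {g G : ℝ → X}
    (hg : IntegrableOn g (Icc (0 : ℝ) 1))
    (hG : ∀ x ∈ Icc (0 : ℝ) 1, G x = G 0 + ∫ s in (0 : ℝ)..x, g s) :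
    ContinuousOn G (Icc 0 1) := by
  refine ContinuousOn.congr (f := fun x => G 0 + ∫ s in (0 : ℝ)..x, g s) ?_ hG
  refine continuousOn_const.add ?_
  have := intervalIntegral.continuousOn_primitive_interval (μ := volume) (f := g) (a := 0) (b := 1)
    (by rwa [uIcc_of_le zero_le_one])
  rwa [uIcc_of_le zero_le_one] at this

variable {X : Type*} [NormedAddCommGroup X] [InnerProductSpace ℂ X] [CompleteSpace X]

/-- Fubini: the two integrals on the left are those of $\langle g(x), h(y)\rangle$ over the triangle
$y \le x$ and over its complement in the unit square. -/
theorem integral_inner_primitive_add {g h : ℝ → X}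
    (hg : IntegrableOn g (Ioc (0 : ℝ) 1)) (hh : IntegrableOn h (Ioc (0 : ℝ) 1)) :
    (∫ x in Ioc (0 : ℝ) 1, ⟪g x, ∫ s in (0 : ℝ)..x, h s⟫_ℂ) +
      (∫ x in Ioc (0 : ℝ) 1, ⟪∫ s in (0 : ℝ)..x, g s, h x⟫_ℂ) =
      ⟪∫ s in (0 : ℝ)..1, g s, ∫ s in (0 : ℝ)..1, h s⟫_ℂ := by
  set μ : Measure ℝ := volume.restrict (Ioc (0 : ℝ) 1) with hμ
  have hK : Integrable (fun p : ℝ × ℝ => ⟪g p.1, h p.2⟫_ℂ) (μ.prod μ) := by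
    refine Integrable.mono' (Integrable.mul_prod hg.norm hh.norm)
      (hg.aestronglyMeasurable.comp_fst.inner hh.aestronglyMeasurable.comp_snd) ?_
    exact Filter.Eventually.of_forall fun p => norm_inner_le_norm _ _
  have hS : MeasurableSet {p : ℝ × ℝ | p.2 ≤ p.1} := measurableSet_le measurable_snd measurable_fst
  have e1 : (∫ x in Ioc (0 : ℝ) 1, ⟪g x, ∫ s in (0 : ℝ)..x, h s⟫_ℂ) =
      ∫ p in {p : ℝ × ℝ | p.2 ≤ p.1}, ⟪g p.1, h p.2⟫_ℂ ∂(μ.prod μ) := by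
    rw [← integral_indicator hS, integral_prod _ (hK.indicator hS)]
    refine setIntegral_congr_fun measurableSet_Ioc fun x hx => ?_
    have : ∀ y, ({p : ℝ × ℝ | p.2 ≤ p.1}.indicator (fun p : ℝ × ℝ => ⟪g p.1, h p.2⟫_ℂ)) (x, y) =
        (Iic x).indicator (fun y => ⟪g x, h y⟫_ℂ) y := fun y => by
      simp [indicator]
    simp only [this]
    rw [integral_indicator measurableSet_Iic, hμ, Measure.restrict_restrict measurableSet_Iic,
      intervalIntegral.integral_of_le hx.1.le]
    have hs : Iic x ∩ Ioc 0 1 = Ioc 0 x := by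
      ext y; simp only [mem_inter_iff, mem_Iic, mem_Ioc]; constructor
      · rintro ⟨a, b, c⟩; exact ⟨b, a⟩
      · rintro ⟨a, b⟩; exact ⟨b, a, b.trans hx.2⟩
    rw [hs, integral_inner]
    exact hh.mono_set (Ioc_subset_Ioc_right hx.2)
  have e2 : (∫ x in Ioc (0 : ℝ) 1, ⟪∫ s in (0 : ℝ)..x, g s, h x⟫_ℂ) =
      ∫ p in {p : ℝ × ℝ | p.2 ≤ p.1}ᶜ, ⟪g p.1, h p.2⟫_ℂ ∂(μ.prod μ) := by
    rw [← integral_indicator hS.compl, integral_prod_symm _ (hK.indicator hS.compl)]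
    refine setIntegral_congr_fun measurableSet_Ioc fun y hy => ?_
    have : ∀ x, ({p : ℝ × ℝ | p.2 ≤ p.1}ᶜ.indicator (fun p : ℝ × ℝ => ⟪g p.1, h p.2⟫_ℂ)) (x, y) =
        (Iio y).indicator (fun x => ⟪g x, h y⟫_ℂ) x := fun x => by
      simp [indicator]
    simp only [this]
    rw [integral_indicator measurableSet_Iio, hμ, Measure.restrict_restrict measurableSet_Iio,
      intervalIntegral.integral_of_le hy.1.le]
    -- The complement of the closed triangle misses the endpoint, which is a null set.
    have hs : Iio y ∩ Ioc 0 1 = Ioo 0 y := by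
      ext x; simp only [mem_inter_iff, mem_Iio, mem_Ioc, mem_Ioo]; constructor
      · rintro ⟨a, b, c⟩; exact ⟨b, a⟩
      · rintro ⟨a, b⟩; exact ⟨b, a, b.le.trans hy.2⟩
    rw [hs, ← integral_Ioc_eq_integral_Ioo, ← inner_conj_symm, ← integral_inner, ← integral_conj]
    · simp
    · exact hg.mono_set (Ioc_subset_Ioc_right hy.2)
  rw [e1, e2, integral_add_compl hS hK, integral_prod _ hK,
    intervalIntegral.integral_of_le zero_le_one, intervalIntegral.integral_of_le zero_le_one]
  have : ∀ x, (∫ y, ⟪g x, h y⟫_ℂ ∂μ) = ⟪g x, ∫ y, h y ∂μ⟫_ℂ := fun x => integral_inner hh _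
  simp only [this]
  rw [← inner_conj_symm, ← integral_inner hg, ← integral_conj]
  simp [hμ]

/-- Integration by parts for two absolutely continuous functions. -/
theorem integral_inner_by_parts {g h G H : ℝ → X}
    (hg : IntegrableOn g (Icc (0 : ℝ) 1)) (hh : IntegrableOn h (Icc (0 : ℝ) 1))
    (hG : ∀ x ∈ Icc (0 : ℝ) 1, G x = G 0 + ∫ s in (0 : ℝ)..x, g s)
    (hH : ∀ x ∈ Icc (0 : ℝ) 1, H x = H 0 + ∫ s in (0 : ℝ)..x, h s) :
    (∫ x in Icc (0 : ℝ) 1, ⟪g x, H x⟫_ℂ) + (∫ x in Icc (0 : ℝ) 1, ⟪G x, h x⟫_ℂ) =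
      ⟪G 1, H 1⟫_ℂ - ⟪G 0, H 0⟫_ℂ := by
  have hg' := hg.mono_set Ioc_subset_Icc_self
  have hh' := hh.mono_set Ioc_subset_Icc_self
  have hbd : ∀ {k K : ℝ → X}, IntegrableOn k (Icc (0 : ℝ) 1) →
      ContinuousOn K (Icc (0 : ℝ) 1) → IntegrableOn (fun x => ⟪k x, K x⟫_ℂ) (Ioc (0 : ℝ) 1) := by
    intro k K hk hK
    obtain ⟨C, hC⟩ := isCompact_Icc.exists_bound_of_continuousOn hK
    refine IntegrableOn.mono_set ?_ Ioc_subset_Icc_self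
    refine Integrable.mono' (hk.norm.mul_const C)
      (hk.aestronglyMeasurable.inner (hK.aestronglyMeasurable measurableSet_Icc)) ?_
    filter_upwards [ae_restrict_mem measurableSet_Icc] with x hx
    exact (norm_inner_le_norm _ _).trans (by gcongr; exact hC x hx)
  have hpg : ContinuousOn (fun x => ∫ s in (0 : ℝ)..x, g s) (Icc 0 1) :=
    continuousOn_of_eq_primitive hg fun x _ => by simp
  have hph : ContinuousOn (fun x => ∫ s in (0 : ℝ)..x, h s) (Icc 0 1) :=
    continuousOn_of_eq_primitive hh fun x _ => by simp
  have i2 := hbd hg hph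
  have i3 : IntegrableOn (fun x => ⟪∫ s in (0 : ℝ)..x, g s, h x⟫_ℂ) (Ioc (0 : ℝ) 1) := by
    have := (hbd hh hpg).norm
    refine Integrable.mono' this ?_ (Filter.Eventually.of_forall fun x => ?_)
    · exact ((hpg.mono Ioc_subset_Icc_self).aestronglyMeasurable measurableSet_Ioc).inner
        hh'.aestronglyMeasurable
    · rw [norm_inner_symm]
  have a1 : (∫ x in Ioc (0 : ℝ) 1, ⟪g x, H x⟫_ℂ) =
      ⟪∫ s in (0 : ℝ)..1, g s, H 0⟫_ℂ + ∫ x in Ioc (0 : ℝ) 1, ⟪g x, ∫ s in (0 : ℝ)..x, h s⟫_ℂ := by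
    rw [intervalIntegral.integral_of_le zero_le_one, ← inner_conj_symm, ← integral_inner hg',
      ← integral_conj, ← integral_add _ i2]
    · refine setIntegral_congr_fun measurableSet_Ioc fun x hx => ?_
      simp only [inner_conj_symm, hH x (Ioc_subset_Icc_self hx), inner_add_right]
    · simp only [inner_conj_symm]
      exact hbd hg continuousOn_const
  have a2 : (∫ x in Ioc (0 : ℝ) 1, ⟪G x, h x⟫_ℂ) =
      ⟪G 0, ∫ s in (0 : ℝ)..1, h s⟫_ℂ + ∫ x in Ioc (0 : ℝ) 1, ⟪∫ s in (0 : ℝ)..x, g s, h x⟫_ℂ := by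
    rw [intervalIntegral.integral_of_le zero_le_one, ← integral_inner hh', ← integral_add _ i3]
    · refine setIntegral_congr_fun measurableSet_Ioc fun x hx => ?_
      simp only [hG x (Ioc_subset_Icc_self hx), inner_add_left]
    · exact hh'.const_inner _
  rw [integral_Icc_eq_integral_Ioc, integral_Icc_eq_integral_Ioc, a1, a2,
    hG 1 (by simp), hH 1 (by simp)]
  have := integral_inner_primitive_add hg' hh'
  simp only [inner_add_left, inner_add_right]
  linear_combination this

end ByParts

/-! ### Constants, means and primitives in $L^2$. -/

section L2Basics

variable {E : Type*} [Fintype E]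

theorem integrableOn_L2 (f : L2 E) : IntegrableOn f (Icc (0 : ℝ) 1) :=
  (Lp.memLp f).integrable one_le_two

theorem intervalIntegrable_L2 (f : L2 E) {x y : ℝ} (hx : x ∈ Icc (0 : ℝ) 1)
    (hy : y ∈ Icc (0 : ℝ) 1) : IntervalIntegrable f volume x y :=
  ((integrableOn_L2 f).mono_set (ordConnected_Icc.uIcc_subset hx hy)).intervalIntegrable

theorem memLp_of_continuousOn {X : Type*} [NormedAddCommGroup X] {F : ℝ → X}
    (hF : ContinuousOn F (Icc (0 : ℝ) 1)) : MemLp F 2 (volume.restrict (Icc (0 : ℝ) 1)) := by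
  obtain ⟨C, hC⟩ := isCompact_Icc.exists_bound_of_continuousOn hF
  refine MemLp.of_bound (hF.aestronglyMeasurable_of_isCompact isCompact_Icc measurableSet_Icc) C ?_
  filter_upwards [ae_restrict_mem measurableSet_Icc] with x hx using hC x hx

theorem intervalIntegral_congr_L2 {f g : ℝ → EuclideanSpace ℂ E}
    (h : f =ᵐ[volume.restrict (Icc (0 : ℝ) 1)] g) {x : ℝ} (hx : x ∈ Icc (0 : ℝ) 1) :
    ∫ s in (0 : ℝ)..x, f s = ∫ s in (0 : ℝ)..x, g s := by
  rw [intervalIntegral.integral_of_le hx.1, intervalIntegral.integral_of_le hx.1]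
  exact integral_congr_ae (ae_mono (Measure.restrict_mono
    (Ioc_subset_Icc_self.trans (Icc_subset_Icc_right hx.2)) le_rfl) h)

/-- The element of `L²` given by a constant vector. -/
abbrev constVec (c : EuclideanSpace ℂ E) : L2 E :=
  Lp.const 2 (volume.restrict (Icc (0 : ℝ) 1)) c

theorem constVec_smul (a : ℂ) (c : EuclideanSpace ℂ E) : constVec (a • c) = a • constVec c :=
  map_smul (Lp.constL 2 (volume.restrict (Icc (0 : ℝ) 1)) ℂ) a c

theorem inner_constVec (c : EuclideanSpace ℂ E) (f : L2 E) :
    ⟪constVec c, f⟫_ℂ = ⟪c, ∫ x in (0 : ℝ)..1, f x⟫_ℂ := by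
  rw [L2.inner_def, intervalIntegral.integral_of_le zero_le_one, ← integral_Icc_eq_integral_Ioc,
    ← integral_inner (integrableOn_L2 f)]
  refine integral_congr_ae ?_
  filter_upwards [Lp.coeFn_const 2 (volume.restrict (Icc (0 : ℝ) 1)) c] with x hx
  rw [hx, Function.const_apply]

theorem intervalIntegral_constVec (c : EuclideanSpace ℂ E) {x : ℝ} (hx : x ∈ Icc (0 : ℝ) 1) :
    ∫ s in (0 : ℝ)..x, constVec c s = x • c := by
  rw [intervalIntegral_congr_L2 (Lp.coeFn_const 2 _ c) hx]
  simp

theorem intervalIntegral_add_L2 (f g : L2 E) {x : ℝ} (hx : x ∈ Icc (0 : ℝ) 1) :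
    ∫ s in (0 : ℝ)..x, (f + g : L2 E) s = (∫ s in (0 : ℝ)..x, f s) + ∫ s in (0 : ℝ)..x, g s := by
  rw [intervalIntegral_congr_L2 (Lp.coeFn_add f g) hx]
  exact intervalIntegral.integral_add (intervalIntegrable_L2 f (by simp) hx)
    (intervalIntegrable_L2 g (by simp) hx)

theorem intervalIntegral_sub_L2 (f g : L2 E) {x : ℝ} (hx : x ∈ Icc (0 : ℝ) 1) :
    ∫ s in (0 : ℝ)..x, (f - g : L2 E) s = (∫ s in (0 : ℝ)..x, f s) - ∫ s in (0 : ℝ)..x, g s := by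
  rw [intervalIntegral_congr_L2 (Lp.coeFn_sub f g) hx]
  exact intervalIntegral.integral_sub (intervalIntegrable_L2 f (by simp) hx)
    (intervalIntegrable_L2 g (by simp) hx)

theorem intervalIntegral_smul_L2 (a : ℂ) (f : L2 E) {x : ℝ} (hx : x ∈ Icc (0 : ℝ) 1) :
    ∫ s in (0 : ℝ)..x, (a • f : L2 E) s = a • ∫ s in (0 : ℝ)..x, f s := by
  rw [intervalIntegral_congr_L2 (Lp.coeFn_smul a f) hx]
  exact intervalIntegral.integral_smul a (f : ℝ → EuclideanSpace ℂ E)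

/-- The constant function `1` on the metric graph. -/
def oneL2 : L2 E := constVec (WithLp.toLp 2 fun _ => 1)

theorem inner_oneL2 (f : L2 E) :
    ⟪oneL2, f⟫_ℂ = ∑ e, (∫ x in (0 : ℝ)..1, f x) e := by
  rw [oneL2, inner_constVec, PiLp.inner_apply]
  simp

theorem intervalIntegral_apply {f : ℝ → EuclideanSpace ℂ E} {a b : ℝ}
    (hf : IntervalIntegrable f volume a b) (e : E) :
    (∫ x in a..b, f x) e = ∫ x in a..b, f x e :=
  ((EuclideanSpace.proj (𝕜 := ℂ) e).intervalIntegral_comp_comm hf).symm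

theorem equilibrium_eq (f : L2 E) :
    equilibrium f = ((Fintype.card E : ℂ)⁻¹ * ⟪oneL2, f⟫_ℂ) • oneL2 := by
  rw [oneL2, ← constVec_smul, equilibrium, ← oneL2, inner_oneL2]
  simp_rw [intervalIntegral_apply (intervalIntegrable_L2 f (left_mem_Icc.2 zero_le_one)
    (right_mem_Icc.2 zero_le_one))]
  congr 1
  ext e
  simp

theorem inner_oneL2_oneL2 : ⟪(oneL2 : L2 E), oneL2⟫_ℂ = Fintype.card E := by
  rw [inner_oneL2, oneL2, intervalIntegral_constVec _ (by simp)]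
  simp

theorem equilibrium_oneL2 [Nonempty E] : equilibrium (oneL2 : L2 E) = oneL2 := by
  rw [equilibrium_eq, inner_oneL2_oneL2, inv_mul_cancel₀ (by simp), one_smul]

theorem inner_oneL2_sub_equilibrium [Nonempty E] (f : L2 E) :
    ⟪oneL2, f - equilibrium f⟫_ℂ = 0 := by
  rw [inner_sub_right, equilibrium_eq, inner_smul_right, inner_oneL2_oneL2]
  field_simp
  simp

theorem continuousOn_add_primitive (a : EuclideanSpace ℂ E) (h : L2 E) :
    ContinuousOn (fun x => a + ∫ s in (0 : ℝ)..x, h s) (Icc 0 1) :=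
  continuousOn_of_eq_primitive (integrableOn_L2 h) fun x _ => by simp

/-- The function `x ↦ a + ∫₀ˣ h` as an element of `L²`. -/
def primitive (a : EuclideanSpace ℂ E) (h : L2 E) : L2 E :=
  (memLp_of_continuousOn (continuousOn_add_primitive a h)).toLp

theorem coeFn_primitive (a : EuclideanSpace ℂ E) (h : L2 E) :
    primitive a h =ᵐ[volume.restrict (Icc (0 : ℝ) 1)] fun x => a + ∫ s in (0 : ℝ)..x, h s :=
  MemLp.coeFn_toLp _

end L2Basics

/-! ### The form domain and the weak formulation of $\Delta^{CK}$. -/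

namespace Multigraph

variable {V E : Type*} [Fintype E]

/-- `f` is of class `H¹` on the metric graph, continuous in the vertices, and `h` is its
derivative. -/
def IsWeakDeriv (Γ : Multigraph V E) (f h : L2 E) : Prop :=
  ∃ F : ℝ → EuclideanSpace ℂ E,
    (f : ℝ → EuclideanSpace ℂ E) =ᵐ[volume.restrict (Icc (0 : ℝ) 1)] F ∧
    (∀ x ∈ Icc (0 : ℝ) 1, F x = F 0 + ∫ s in (0 : ℝ)..x, h s) ∧
    ∃ φ : V → ℂ, ∀ e : E, F 0 e = φ (Γ.src e) ∧ F 1 e = φ (Γ.tgt e)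

variable {Γ : Multigraph V E}

theorem isWeakDeriv_oneL2 : Γ.IsWeakDeriv oneL2 0 := by
  refine ⟨fun _ => WithLp.toLp 2 fun _ => 1, Lp.coeFn_const _ _ _, fun x hx => ?_,
    fun _ => 1, by simp⟩
  rw [intervalIntegral_congr_L2 (Lp.coeFn_zero _ _ _) hx]
  simp

theorem IsWeakDeriv.add {f h f' h' : L2 E} (H : Γ.IsWeakDeriv f h) (H' : Γ.IsWeakDeriv f' h') :
    Γ.IsWeakDeriv (f + f') (h + h') := by
  obtain ⟨F, a, b, φ, c⟩ := H
  obtain ⟨F', a', b', φ', c'⟩ := H'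
  refine ⟨F + F', (Lp.coeFn_add _ _).trans (a.add a'), fun x hx => ?_, φ + φ', fun e => ?_⟩
  · rw [intervalIntegral_add_L2 _ _ hx, Pi.add_apply, Pi.add_apply, b x hx, b' x hx]
    abel
  · simp [c e, c' e]

theorem IsWeakDeriv.smul {f h : L2 E} (H : Γ.IsWeakDeriv f h) (z : ℂ) :
    Γ.IsWeakDeriv (z • f) (z • h) := by
  obtain ⟨F, a, b, φ, c⟩ := H
  refine ⟨z • F, (Lp.coeFn_smul _ _).trans (a.const_smul z), fun x hx => ?_, z • φ, fun e => ?_⟩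
  · rw [intervalIntegral_smul_L2 _ _ hx, Pi.smul_apply, Pi.smul_apply, b x hx, smul_add]
  · simp [c e]

theorem IsWeakDeriv.sub {f h f' h' : L2 E} (H : Γ.IsWeakDeriv f h) (H' : Γ.IsWeakDeriv f' h') :
    Γ.IsWeakDeriv (f - f') (h - h') := by
  simpa [sub_eq_add_neg] using H.add (H'.smul (-1))

theorem IsWeakDeriv.sub_equilibrium {f h : L2 E} (H : Γ.IsWeakDeriv f h) :
    Γ.IsWeakDeriv (f - equilibrium f) h := by
  rw [equilibrium_eq]
  simpa using H.sub (isWeakDeriv_oneL2.smul ((Fintype.card E : ℂ)⁻¹ * ⟪oneL2, f⟫_ℂ))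

theorem isWeakDeriv_primitive {a : EuclideanSpace ℂ E} {h : L2 E} {φ : V → ℂ}
    (ha : ∀ e, a e = φ (Γ.src e))
    (hh : ∀ e, (∫ s in (0 : ℝ)..1, h s) e = φ (Γ.tgt e) - φ (Γ.src e)) :
    Γ.IsWeakDeriv (primitive a h) h :=
  ⟨_, coeFn_primitive a h, fun x hx => by simp, φ, fun e => by simp [ha, hh]⟩

theorem IsWeakDeriv.exists_integral_eq {f h : L2 E} (H : Γ.IsWeakDeriv f h) :
    ∃ φ : V → ℂ, ∀ e, (∫ s in (0 : ℝ)..1, h s) e = φ (Γ.tgt e) - φ (Γ.src e) := by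
  obtain ⟨F, a, b, φ, c⟩ := H
  refine ⟨φ, fun e => ?_⟩
  rw [← (c e).1, ← (c e).2, b 1 (by simp)]
  simp

theorem Connected.const_of_edges {V E : Type*} {Γ : Multigraph V E} (hΓ : Γ.Connected) {φ : V → ℂ}
    (h : ∀ e, φ (Γ.src e) = φ (Γ.tgt e)) (v w : V) : φ v = φ w := by
  obtain ⟨p⟩ := hΓ.preconnected v w
  induction p with
  | nil => rfl
  | cons hadj _ ih =>
    rw [← ih]
    rw [SimpleGraph.fromRel_adj] at hadj
    obtain ⟨_, ⟨e, rfl, rfl⟩ | ⟨e, rfl, rfl⟩⟩ := hadj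
    · exact h e
    · exact (h e).symm

/-- The function is constant on each edge, so its vertex values agree across edges and therefore
everywhere. Connectedness enters the whole argument only here. -/
theorem IsWeakDeriv.eq_smul_oneL2 (hΓ : Γ.Connected) {f : L2 E} (H : Γ.IsWeakDeriv f 0) :
    ∃ c : ℂ, f = c • oneL2 := by
  obtain ⟨F, a, b, φ, c⟩ := H
  have b' : ∀ x ∈ Icc (0 : ℝ) 1, F x = F 0 := fun x hx => by
    rw [b x hx, intervalIntegral_congr_L2 (Lp.coeFn_zero _ _ _) hx]
    simp
  obtain ⟨v⟩ := hΓ.nonempty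
  have hφ := hΓ.const_of_edges (φ := φ) (fun e => by
    rw [← (c e).1, ← (c e).2, b' 1 (by simp)])
  refine ⟨φ v, ?_⟩
  rw [oneL2, ← constVec_smul]
  refine Lp.ext ((a.trans ?_).trans (Lp.coeFn_const _ _ _).symm)
  filter_upwards [ae_restrict_mem measurableSet_Icc] with x hx
  rw [b' x hx]
  ext e
  simp [(c e).1, hφ (Γ.src e) v]

/-- The weak form of the operator `Δ^CK`. -/
theorem IsCKLaplacian.exists_continuousOn_isWeakDeriv [Fintype V] {f g : L2 E}
    (H : Γ.IsCKLaplacian f g) :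
    ∃ h : L2 E, (∃ F' : ℝ → EuclideanSpace ℂ E, ContinuousOn F' (Icc 0 1) ∧
      h =ᵐ[volume.restrict (Icc (0 : ℝ) 1)] F') ∧ Γ.IsWeakDeriv f h ∧
      ∀ k k', Γ.IsWeakDeriv k k' → ⟪g, k⟫_ℂ = -⟪h, k'⟫_ℂ := by
  classical
  obtain ⟨F, F', a, b, b', hφ, hK⟩ := H
  have hc := continuousOn_of_eq_primitive (integrableOn_L2 g) b'
  have hh := (memLp_of_continuousOn hc).coeFn_toLp
  refine ⟨(memLp_of_continuousOn hc).toLp, ⟨F', hc, hh⟩, ⟨F, a, fun x hx => ?_, hφ⟩, ?_⟩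
  · rw [intervalIntegral_congr_L2 hh hx, b x hx]
  rintro k k' ⟨G, c, d, ψ, hψ⟩
  have key := integral_inner_by_parts (integrableOn_L2 g) (integrableOn_L2 k') b' d
  have e1 : ⟪g, k⟫_ℂ = ∫ x in Icc (0 : ℝ) 1, ⟪g x, G x⟫_ℂ := by
    rw [L2.inner_def]
    refine integral_congr_ae ?_
    filter_upwards [c] with x hx
    rw [hx]
  have e2 : ⟪(memLp_of_continuousOn hc).toLp, k'⟫_ℂ = ∫ x in Icc (0 : ℝ) 1, ⟪F' x, k' x⟫_ℂ := by
    rw [L2.inner_def]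
    refine integral_congr_ae ?_
    filter_upwards [hh] with x hx
    rw [hx]
  have e3 : ⟪F' 1, G 1⟫_ℂ - ⟪F' 0, G 0⟫_ℂ = 0 := by
    rw [PiLp.inner_apply, PiLp.inner_apply, ← Finset.sum_sub_distrib]
    -- The boundary terms are regrouped by vertices: continuity of the test function lets its value
    -- at $v$ factor out of the Kirchhoff sum at $v$.
    have : ∀ e, ⟪F' 1 e, G 1 e⟫_ℂ - ⟪F' 0 e, G 0 e⟫_ℂ = ∑ v, ψ v * starRingEnd ℂ
        ((if Γ.tgt e = v then F' 1 e else 0) - (if Γ.src e = v then F' 0 e else 0)) := fun e => by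
      simp [(hψ e).1, (hψ e).2, mul_sub, Finset.sum_sub_distrib, apply_ite (starRingEnd ℂ)]
    simp_rw [this]
    rw [Finset.sum_comm]
    refine Finset.sum_eq_zero fun v _ => ?_
    have hv := hK v
    rw [← Finset.mul_sum, ← map_sum]
    convert mul_zero (ψ v)
    rw [map_eq_zero]
    convert hv
  rw [e1, e2]
  linear_combination key + e3

theorem IsCKLaplacian.exists_isWeakDeriv [Fintype V] {f g : L2 E} (H : Γ.IsCKLaplacian f g) :
    ∃ h, Γ.IsWeakDeriv f h ∧ ∀ k k', Γ.IsWeakDeriv k k' → ⟪g, k⟫_ℂ = -⟪h, k'⟫_ℂ :=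
  let ⟨h, _, hw, hk⟩ := H.exists_continuousOn_isWeakDeriv
  ⟨h, hw, hk⟩

/-- Elliptic regularity: the weak form of `Δ^CK f = g` implies the strong one. -/
theorem isCKLaplacian_of_weak {f g h : L2 E} (H : Γ.IsWeakDeriv f h)
    (hw : ∀ k k', Γ.IsWeakDeriv k k' → ⟪g, k⟫_ℂ = -⟪h, k'⟫_ℂ) : Γ.IsCKLaplacian f g := by
  classical
  set P : L2 E := primitive 0 g with hP
  have hPc := coeFn_primitive 0 g
  simp only [zero_add] at hPc
  have parts : ∀ (a : EuclideanSpace ℂ E) (k' : L2 E) (φ : V → ℂ), (∀ e, a e = φ (Γ.src e)) →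
      (∀ e, (∫ s in (0 : ℝ)..1, k' s) e = φ (Γ.tgt e) - φ (Γ.src e)) →
      ⟪P - h, k'⟫_ℂ = ⟪∫ s in (0 : ℝ)..1, g s, a + ∫ s in (0 : ℝ)..1, k' s⟫_ℂ := by
    intro a k' φ ha hk
    have h1 := hw _ _ (isWeakDeriv_primitive ha hk)
    have key := integral_inner_by_parts (integrableOn_L2 g) (integrableOn_L2 k')
      (G := fun x => ∫ s in (0 : ℝ)..x, g s) (H := fun x => a + ∫ s in (0 : ℝ)..x, k' s)
      (fun x _ => by simp) (fun x _ => by simp)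
    have e1 : ⟪g, primitive a k'⟫_ℂ =
        ∫ x in Icc (0 : ℝ) 1, ⟪g x, a + ∫ s in (0 : ℝ)..x, k' s⟫_ℂ := by
      rw [L2.inner_def]
      refine integral_congr_ae ?_
      filter_upwards [coeFn_primitive a k'] with x hx
      rw [hx]
    have e2 : ⟪P, k'⟫_ℂ = ∫ x in Icc (0 : ℝ) 1, ⟪∫ s in (0 : ℝ)..x, g s, k' x⟫_ℂ := by
      rw [L2.inner_def]
      refine integral_congr_ae ?_
      filter_upwards [hPc] with x hx
      rw [hx]
    rw [← e1, ← e2] at key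
    simp only [intervalIntegral.integral_same, inner_zero_left, sub_zero] at key
    rw [inner_sub_left, ← key, h1]
    ring
  set c := ∫ s in (0 : ℝ)..1, (P - h : L2 E) s with hc
  -- Du Bois-Reymond: $P - h - c$ has mean zero on each edge, so its primitive vanishing at every
  -- vertex is an admissible test function. It makes $P - h$ orthogonal to $P - h - c$; so is $c$,
  -- hence $P - h - c = 0$.
  have hPh : P - h = constVec c := by
    have hz : ∫ s in (0 : ℝ)..1, (P - h - constVec c : L2 E) s = 0 := by
      rw [intervalIntegral_sub_L2 _ _ (by simp), ← hc, intervalIntegral_constVec _ (by simp)]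
      simp
    have h1 := parts 0 (P - h - constVec c) 0 (by simp) (by rw [hz]; simp)
    rw [hz, add_zero, inner_zero_right] at h1
    have h2 := inner_constVec c (P - h - constVec c)
    rw [hz, inner_zero_right] at h2
    rw [← sub_eq_zero, ← inner_self_eq_zero (𝕜 := ℂ), inner_sub_left, h1, h2, sub_zero]
  have hh : (h : ℝ → EuclideanSpace ℂ E) =ᵐ[volume.restrict (Icc (0 : ℝ) 1)]
      fun x => -c + ∫ s in (0 : ℝ)..x, g s := by
    have : h = P - constVec c := by rw [← hPh]; abel
    rw [this]
    filter_upwards [Lp.coeFn_sub P (constVec c), hPc, Lp.coeFn_const 2 _ c] with x h1 h2 h3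
    rw [h1, Pi.sub_apply, h2, h3, Function.const_apply]
    abel
  obtain ⟨F, a, b, hφ⟩ := H
  refine ⟨F, fun x => -c + ∫ s in (0 : ℝ)..x, g s, a, fun x hx => ?_, fun x hx => by simp, hφ,
    fun v => ?_⟩
  · rw [b x hx, intervalIntegral_congr_L2 hh hx]
  -- The edgewise affine test function equal to 1 at $v$ and 0 at the other vertices isolates the
  -- Kirchhoff sum at $v$.
  let φ : V → ℂ := fun w => if w = v then 1 else 0
  let y : EuclideanSpace ℂ E := WithLp.toLp 2 fun e => φ (Γ.tgt e) - φ (Γ.src e)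
  have hy : ∫ s in (0 : ℝ)..1, constVec y s = y := by
    rw [intervalIntegral_constVec _ (by simp), one_smul]
  have key := parts (WithLp.toLp 2 fun e => φ (Γ.src e)) (constVec y) φ (fun e => rfl)
    (by rw [hy]; exact fun e => rfl)
  rw [hPh, inner_constVec, hy, PiLp.inner_apply, PiLp.inner_apply, ← sub_eq_zero,
    ← Finset.sum_sub_distrib] at key
  have key' := congrArg (starRingEnd ℂ) key
  rw [map_zero, map_sum, ← neg_eq_zero, ← Finset.sum_neg_distrib] at key'
  rw [← key']
  refine Finset.sum_congr rfl fun e _ => ?_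
  simp only [y, φ, intervalIntegral.integral_same, PiLp.add_apply, PiLp.neg_apply,
    RCLike.inner_apply, map_sub, map_mul, RCLike.conj_conj, apply_ite (starRingEnd ℂ), map_one,
    map_zero, map_add, PiLp.zero_apply]
  split_ifs <;> ring

end Multigraph

/-! ### Compact operators and compactness of antidifferentiation. -/

/-- A nonzero compact operator on a Hilbert space attains its norm: `‖A‖ ^ 2` is an eigenvalue of
`A ∘ A†`. -/
theorem exists_eigenvector_comp_adjoint {H : Type*} [NormedAddCommGroup H] [InnerProductSpace ℂ H]
    [CompleteSpace H] {A : H →L[ℂ] H} (hA : IsCompactOperator A) (h0 : A ≠ 0) :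
    ∃ f : H, f ≠ 0 ∧ A ((A†) f) = ((‖A‖ ^ 2 : ℝ) : ℂ) • f := by
  have hnt : Nontrivial H := by
    by_contra h
    rw [not_nontrivial_iff_subsingleton] at h
    exact h0 (Subsingleton.elim _ _)
  set S : H →L[ℂ] H := A ∘L (A†) with hS
  have hSA : ‖S‖ = ‖A‖ ^ 2 := by
    have := ContinuousLinearMap.norm_adjoint_comp_self (A†)
    rw [ContinuousLinearMap.adjoint_adjoint, LinearIsometryEquiv.norm_map] at this
    rw [hS, this, sq]
  have hSsa : IsSelfAdjoint S :=
    (ContinuousLinearMap.isPositive_self_comp_adjoint A).isSelfAdjoint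
  have hSc : IsCompactOperator S := hA.comp_clm (A†)
  -- For self-adjoint `S` the spectral radius is the norm, so some spectral value has modulus
  -- $\|A\|^2$. It is nonzero, hence an eigenvalue by compactness.
  obtain ⟨z, hz, hzn⟩ := spectrum.exists_nnnorm_eq_spectralRadius S
  rw [S.spectralRadius_eq_nnnorm hSsa, ENNReal.coe_inj] at hzn
  have hzn' : ‖z‖ = ‖A‖ ^ 2 := by rw [← hSA, ← coe_nnnorm, hzn, coe_nnnorm]
  have hApos : 0 < ‖A‖ := norm_pos_iff.2 h0
  have hz0 : z ≠ 0 := by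
    rw [← norm_pos_iff, hzn']
    positivity
  obtain ⟨f, hf⟩ := ((hSc.hasEigenvalue_iff_mem_spectrum hz0).2 hz).exists_hasEigenvector
  have hf0 : f ≠ 0 := hf.2
  have hf1 : A ((A†) f) = z • f := hf.apply_eq_smul
  refine ⟨f, hf0, ?_⟩
  -- Pairing with `f` shows that `z` is a nonnegative real, hence equal to its modulus.
  have h1 : z * (‖f‖ ^ 2 : ℝ) = (‖(A†) f‖ ^ 2 : ℝ) := by
    have h2 : ⟪f, A ((A†) f)⟫_ℂ = ⟪(A†) f, (A†) f⟫_ℂ := (A.adjoint_inner_left _ _).symm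
    rw [hf1, inner_smul_right, inner_self_eq_norm_sq_to_K, inner_self_eq_norm_sq_to_K] at h2
    exact_mod_cast h2
  have hfpos : (0 : ℝ) < ‖f‖ ^ 2 := by positivity
  have h3 : z = ((‖(A†) f‖ ^ 2 / ‖f‖ ^ 2 : ℝ) : ℂ) := by
    rw [Complex.ofReal_div, ← h1, mul_div_cancel_right₀]
    exact_mod_cast hfpos.ne'
  have h4 : ‖z‖ = ‖(A†) f‖ ^ 2 / ‖f‖ ^ 2 := by
    rw [h3, Complex.norm_real, Real.norm_of_nonneg (by positivity)]
  rw [hf1, ← hzn', h4, ← h3]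

section Primitive

variable {E : Type*} [Fintype E]

theorem norm_intervalIntegral_L2_le (h : L2 E) {x y : ℝ} (hx : x ∈ Icc (0 : ℝ) 1)
    (hy : y ∈ Icc (0 : ℝ) 1) (hxy : x ≤ y) :
    ‖∫ s in x..y, h s‖ ≤ ‖h‖ * √(y - x) := by
  have hsub : Ioc x y ⊆ Icc (0 : ℝ) 1 :=
    Ioc_subset_Icc_self.trans (Icc_subset_Icc hx.1 hy.2)
  have hle : volume.restrict (Ioc x y) ≤ volume.restrict (Icc (0 : ℝ) 1) :=
    Measure.restrict_mono hsub le_rfl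
  have h1 : ‖∫ s in x..y, h s‖ₑ ≤
      eLpNorm h 2 (volume.restrict (Icc (0 : ℝ) 1)) * ENNReal.ofReal (y - x) ^ (1 / 2 : ℝ) := by
    rw [intervalIntegral.integral_of_le hxy]
    refine (enorm_integral_le_lintegral_enorm _).trans ?_
    rw [← eLpNorm_one_eq_lintegral_enorm]
    refine (eLpNorm_le_eLpNorm_mul_rpow_measure_univ (q := 2) one_le_two
      ((Lp.aestronglyMeasurable h).mono_measure hle)).trans ?_
    refine mul_le_mul' (eLpNorm_mono_measure _ hle) (le_of_eq ?_)
    rw [Measure.restrict_apply_univ, Real.volume_Ioc]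
    norm_num
  have h2 := ENNReal.toReal_mono (ENNReal.mul_ne_top (Lp.eLpNorm_ne_top h)
    (ENNReal.rpow_ne_top_of_nonneg (by norm_num) ENNReal.ofReal_ne_top)) h1
  rw [ENNReal.toReal_mul, ← Lp.norm_def, ← ENNReal.toReal_rpow,
    ENNReal.toReal_ofReal (sub_nonneg.2 hxy), ← Real.sqrt_eq_rpow] at h2
  simpa using h2

/-- The function `x ↦ B (∫₀¹ h) + ∫₀ˣ h` on `[0,1]`. -/
def primitiveBCF (B : EuclideanSpace ℂ E →ₗ[ℂ] EuclideanSpace ℂ E) (h : L2 E) :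
    BoundedContinuousFunction (Icc (0 : ℝ) 1) (EuclideanSpace ℂ E) :=
  BoundedContinuousFunction.mkOfCompact
    ⟨fun x => B (∫ s in (0 : ℝ)..1, h s) + ∫ s in (0 : ℝ)..x, h s,
      (continuousOn_add_primitive _ h).domRestrict⟩

/-- Cauchy–Schwarz bounds the primitives of the $L^2$ unit ball uniformly and gives them the common
modulus of continuity $\sqrt{d}$, so Arzelà–Ascoli applies. -/
theorem isCompact_closure_primitiveBCF_image
    (B : EuclideanSpace ℂ E →ₗ[ℂ] EuclideanSpace ℂ E) :
    IsCompact (closure (primitiveBCF B '' Metric.closedBall (0 : L2 E) 1)) := by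
  let B' := B.toContinuousLinearMap
  have h01 : (0 : ℝ) ∈ Icc (0 : ℝ) 1 := by simp
  have h11 : (1 : ℝ) ∈ Icc (0 : ℝ) 1 := by simp
  refine BoundedContinuousFunction.arzela_ascoli (Metric.closedBall 0 (‖B'‖ + 1))
    (isCompact_closedBall _ _) _ ?_ ?_
  · rintro _ x ⟨h, hh, rfl⟩
    rw [mem_closedBall_zero_iff] at hh ⊢
    have b1 := norm_intervalIntegral_L2_le h h01 h11 zero_le_one
    have b2 := norm_intervalIntegral_L2_le h h01 x.2 x.2.1
    have b3 : √((x : ℝ) - 0) ≤ 1 := by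
      rw [sub_zero]
      exact Real.sqrt_le_one.2 x.2.2
    rw [sub_zero, Real.sqrt_one, mul_one] at b1
    have b4 : ‖B (∫ s in (0 : ℝ)..1, h s)‖ ≤ ‖B'‖ * ‖h‖ :=
      (B'.le_opNorm _).trans (by gcongr)
    calc ‖B (∫ s in (0 : ℝ)..1, h s) + ∫ s in (0 : ℝ)..x, h s‖
        ≤ ‖B'‖ * ‖h‖ + ‖h‖ * √((x : ℝ) - 0) := (norm_add_le _ _).trans (add_le_add b4 b2)
      _ ≤ ‖B'‖ * 1 + 1 * 1 := by gcongr
      _ = ‖B'‖ + 1 := by ring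
  · refine Metric.equicontinuous_of_continuity_modulus (fun d => √d) ?_ _ ?_
    · simpa using Real.continuous_sqrt.tendsto 0
    · rintro x y ⟨_, h, hh, rfl⟩
      rw [mem_closedBall_zero_iff] at hh
      have main : ∀ x y : Icc (0 : ℝ) 1, x ≤ y →
          dist (primitiveBCF B h x) (primitiveBCF B h y) ≤ √(dist x y) := by
        intro x y hxy
        have hxy' : (x : ℝ) ≤ y := hxy
        change dist (B (∫ s in (0 : ℝ)..1, h s) + ∫ s in (0 : ℝ)..x, h s)
          (B (∫ s in (0 : ℝ)..1, h s) + ∫ s in (0 : ℝ)..y, h s) ≤ _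
        rw [dist_add_left, dist_comm, dist_eq_norm, intervalIntegral.integral_interval_sub_left
          (intervalIntegrable_L2 h h01 y.2) (intervalIntegrable_L2 h h01 x.2)]
        refine (norm_intervalIntegral_L2_le h x.2 y.2 hxy').trans ?_
        rw [Subtype.dist_eq, dist_comm, Real.dist_eq, abs_of_nonneg (sub_nonneg.2 hxy')]
        calc ‖h‖ * √((y : ℝ) - x) ≤ 1 * √((y : ℝ) - x) := by gcongr
          _ = _ := one_mul _
      rcases le_total x y with hxy | hxy
      · exact main x y hxy
      · rw [dist_comm, dist_comm x y]
        exact main y x hxy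

/-- The operator `h ↦ (x ↦ B (∫₀¹ h) + ∫₀ˣ h)` on `L²`. -/
def primitiveLM (B : EuclideanSpace ℂ E →ₗ[ℂ] EuclideanSpace ℂ E) : L2 E →ₗ[ℂ] L2 E where
  toFun h := primitive (B (∫ s in (0 : ℝ)..1, h s)) h
  map_add' f g := by
    refine Lp.ext ?_
    filter_upwards [coeFn_primitive (B (∫ s in (0 : ℝ)..1, (f + g : L2 E) s)) (f + g),
      coeFn_primitive (B (∫ s in (0 : ℝ)..1, f s)) f,
      coeFn_primitive (B (∫ s in (0 : ℝ)..1, g s)) g,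
      Lp.coeFn_add (primitive (B (∫ s in (0 : ℝ)..1, f s)) f)
        (primitive (B (∫ s in (0 : ℝ)..1, g s)) g),
      ae_restrict_mem measurableSet_Icc] with x h1 h2 h3 h4 hx
    rw [h1, h4, Pi.add_apply, h2, h3, intervalIntegral_add_L2 _ _ hx,
      intervalIntegral_add_L2 _ _ (right_mem_Icc.2 zero_le_one), map_add]
    abel
  map_smul' a f := by
    refine Lp.ext ?_
    filter_upwards [coeFn_primitive (B (∫ s in (0 : ℝ)..1, (a • f : L2 E) s)) (a • f),
      coeFn_primitive (B (∫ s in (0 : ℝ)..1, f s)) f,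
      Lp.coeFn_smul a (primitive (B (∫ s in (0 : ℝ)..1, f s)) f),
      ae_restrict_mem measurableSet_Icc] with x h1 h2 h4 hx
    rw [h1, RingHom.id_apply, h4, Pi.smul_apply, h2, intervalIntegral_smul_L2 _ _ hx,
      intervalIntegral_smul_L2 _ _ (right_mem_Icc.2 zero_le_one), map_smul, smul_add]

/-- The operator factors through the continuous functions, whose inclusion `ι` into $L^2$ is
continuous and so preserves compactness. -/
theorem isCompactOperator_primitiveLM (B : EuclideanSpace ℂ E →ₗ[ℂ] EuclideanSpace ℂ E) :
    IsCompactOperator (primitiveLM B) := by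
  let pr : C(ℝ, Icc (0 : ℝ) 1) := ⟨projIcc 0 1 zero_le_one, continuous_projIcc⟩
  let ι : BoundedContinuousFunction (Icc (0 : ℝ) 1) (EuclideanSpace ℂ E) → L2 E := fun f =>
    BoundedContinuousFunction.toLp 2 (volume.restrict (Icc (0 : ℝ) 1)) ℂ (f.compContinuous pr)
  have hι : Continuous ι := (ContinuousLinearMap.continuous _).comp
    (BoundedContinuousFunction.continuous_compContinuous pr)
  have hT : ∀ h, primitiveLM B h = ι (primitiveBCF B h) := fun h => by
    refine Lp.ext ((coeFn_primitive _ h).trans ?_)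
    filter_upwards [BoundedContinuousFunction.coeFn_toLp 2 (volume.restrict (Icc (0 : ℝ) 1)) ℂ
      ((primitiveBCF B h).compContinuous pr), ae_restrict_mem measurableSet_Icc] with x h1 hx
    rw [h1]
    simp only [BoundedContinuousFunction.compContinuous_apply, pr, ContinuousMap.coe_mk,
      projIcc_of_mem zero_le_one hx]
    rfl
  refine ⟨ι '' closure (primitiveBCF B '' Metric.closedBall (0 : L2 E) 1),
    (isCompact_closure_primitiveBCF_image B).image hι,
    Filter.mem_of_superset (Metric.closedBall_mem_nhds 0 one_pos) fun h hh => ?_⟩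
  rw [mem_preimage, hT]
  exact mem_image_of_mem _ (subset_closure (mem_image_of_mem _ hh))

/-- The mean value over the metric graph as an operator on `L²`. -/
def equilibriumL : L2 E →L[ℂ] L2 E :=
  (Fintype.card E : ℂ)⁻¹ • (innerSL ℂ (oneL2 : L2 E)).smulRight oneL2

theorem equilibriumL_apply (f : L2 E) : equilibriumL f = equilibrium f := by
  simp [equilibriumL, equilibrium_eq, smul_smul]

/-- The integral over `[0,1]` as an operator on `L²`. -/
def integralL : L2 E →L[ℂ] EuclideanSpace ℂ E :=
  LinearMap.mkContinuous
    { toFun := fun h => ∫ s in (0 : ℝ)..1, h s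
      map_add' := fun f g => intervalIntegral_add_L2 f g (right_mem_Icc.2 zero_le_one)
      map_smul' := fun a f => intervalIntegral_smul_L2 a f (right_mem_Icc.2 zero_le_one) } 1
    fun h => by
      have := norm_intervalIntegral_L2_le h (left_mem_Icc.2 zero_le_one)
        (right_mem_Icc.2 zero_le_one) zero_le_one
      simpa using this

/-- Serves to show $A \ne 0$. The function $(x^2 - x)/2$ on every edge vanishes at all vertices,
hence is admissible on any graph, and its values at $0$ and $1/2$ differ. -/
theorem exists_primitive_not_const [Nonempty E] :
    ∃ h : L2 E, ∫ s in (0 : ℝ)..1, h s = 0 ∧ ∀ c : ℂ, primitive 0 h ≠ c • oneL2 := by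
  let u : EuclideanSpace ℂ E := WithLp.toLp 2 fun _ => 1
  have hu : u ≠ 0 := fun h => by
    obtain ⟨e⟩ := ‹Nonempty E›
    simpa [u] using congrArg (fun w : EuclideanSpace ℂ E => w e) h
  have hcont : Continuous fun x : ℝ => (x - 1 / 2) • u := by fun_prop
  obtain ⟨w, hw⟩ : ∃ w : L2 E, w =ᵐ[volume.restrict (Icc (0 : ℝ) 1)] fun x => (x - 1 / 2) • u :=
    ⟨_, (memLp_of_continuousOn hcont.continuousOn).coeFn_toLp⟩
  have hint : ∀ x ∈ Icc (0 : ℝ) 1, ∫ s in (0 : ℝ)..x, w s = (x ^ 2 / 2 - x / 2) • u := by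
    intro x hx
    rw [intervalIntegral_congr_L2 hw hx, intervalIntegral.integral_smul_const]
    congr 1
    simp
    ring
  refine ⟨w, by rw [hint 1 (by simp)]; simp, fun c hc => ?_⟩
  have hae : (fun x : ℝ => (x ^ 2 / 2 - x / 2) • u) =ᵐ[volume.restrict (Icc (0 : ℝ) 1)]
      fun _ => c • u := by
    have h1 := coeFn_primitive 0 w
    rw [hc, oneL2, ← constVec_smul] at h1
    filter_upwards [h1, Lp.coeFn_const 2 (volume.restrict (Icc (0 : ℝ) 1)) (c • u),
      ae_restrict_mem measurableSet_Icc] with x h1 h2 hx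
    rw [← hint x hx, ← zero_add (∫ s in (0 : ℝ)..x, w s), ← h1, h2, Function.const_apply]
  have heq : EqOn (fun x : ℝ => (x ^ 2 / 2 - x / 2) • u) (fun _ => c • u) (Icc 0 1) :=
    Measure.eqOn_Icc_of_ae_eq volume zero_ne_one hae
      (by fun_prop) (by fun_prop)
  have h0 := heq (left_mem_Icc.2 zero_le_one)
  have h1 := heq (show (1 / 2 : ℝ) ∈ Icc (0 : ℝ) 1 by norm_num)
  have : (((1 / 2 : ℝ) ^ 2 / 2 - (1 / 2) / 2) • u) = 0 := by
    simp only at h0 h1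
    rw [h1, ← h0]
    simp
  rw [smul_eq_zero] at this
  norm_num at this
  exact hu this

end Primitive

/-! ### The sharp Poincaré inequality. -/

namespace Multigraph

variable {V E : Type*} [Fintype E]

/-- The coboundary operator: differences of the values of a function on the vertices. -/
def coboundary (Γ : Multigraph V E) : (V → ℂ) →ₗ[ℂ] EuclideanSpace ℂ E where
  toFun φ := WithLp.toLp 2 fun e => φ (Γ.tgt e) - φ (Γ.src e)
  map_add' φ ψ := by ext e; simp; ring
  map_smul' a φ := by ext e; simp; ring

/-- A choice of vertex values with prescribed differences, evaluated at the starting points of the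
edges. -/
theorem exists_coboundary_section (Γ : Multigraph V E) :
    ∃ G : EuclideanSpace ℂ E →ₗ[ℂ] (V → ℂ), ∀ y ∈ LinearMap.range Γ.coboundary,
      Γ.coboundary (G y) = y := by
  obtain ⟨s, hs⟩ := Γ.coboundary.rangeRestrict.exists_rightInverse_of_surjective
    Γ.coboundary.range_rangeRestrict
  obtain ⟨G, hG⟩ := s.exists_extend
  refine ⟨G, fun y hy => ?_⟩
  have h1 : G y = s ⟨y, hy⟩ := by rw [← hG]; rfl
  have h2 := congrArg Subtype.val (LinearMap.congr_fun hs ⟨y, hy⟩)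
  rw [h1]
  exact h2

/-- The square integrable functions that are derivatives of functions continuous in the vertices. -/
def derivSubspace (Γ : Multigraph V E) : Submodule ℂ (L2 E) :=
  (LinearMap.range Γ.coboundary).comap (integralL : L2 E →L[ℂ] EuclideanSpace ℂ E).toLinearMap

theorem isClosed_derivSubspace (Γ : Multigraph V E) : IsClosed (Γ.derivSubspace : Set (L2 E)) :=
  (Submodule.closed_of_finiteDimensional (LinearMap.range Γ.coboundary)).preimage
    integralL.continuous

variable {Γ : Multigraph V E}

theorem mem_derivSubspace {h : L2 E} : h ∈ Γ.derivSubspace ↔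
    ∃ φ : V → ℂ, ∀ e, (∫ s in (0 : ℝ)..1, h s) e = φ (Γ.tgt e) - φ (Γ.src e) := by
  constructor
  · rintro ⟨φ, hφ⟩
    exact ⟨φ, fun e => (congrArg (fun w : EuclideanSpace ℂ E => w e) hφ).symm⟩
  · rintro ⟨φ, hφ⟩
    refine ⟨φ, ?_⟩
    ext e
    exact (hφ e).symm

/-- A linear section of the coboundary chooses vertex values from the increments along the edges,
and these values are the constants of integration. -/
theorem exists_compact_primitive (Γ : Multigraph V E) :
    ∃ T : L2 E →L[ℂ] L2 E, IsCompactOperator T ∧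
      ∀ h ∈ Γ.derivSubspace, Γ.IsWeakDeriv (T h) h := by
  obtain ⟨G, hG⟩ := Γ.exists_coboundary_section
  let B : EuclideanSpace ℂ E →ₗ[ℂ] EuclideanSpace ℂ E :=
    { toFun := fun y => WithLp.toLp 2 fun e => G y (Γ.src e)
      map_add' := fun x y => by ext e; simp
      map_smul' := fun a x => by ext e; simp }
  refine ⟨ContinuousLinearMap.mkOfIsCompactOperator (isCompactOperator_primitiveLM B),
    isCompactOperator_primitiveLM B, fun h hh => ?_⟩
  refine isWeakDeriv_primitive (φ := G (∫ s in (0 : ℝ)..1, h s)) (fun e => rfl) fun e => ?_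
  exact (congrArg (fun w : EuclideanSpace ℂ E => w e) (hG _ hh)).symm

/-- The sharp Poincaré inequality on a connected metric graph: the optimal constant is positive
and is an eigenvalue of `-Δ^CK`. -/
theorem Connected.exists_spectralGap [Nonempty E] (hΓ : Γ.Connected) :
    ∃ lam : ℝ, 0 < lam ∧
      (∀ k k', Γ.IsWeakDeriv k k' → lam * ‖k - equilibrium k‖ ^ 2 ≤ ‖k'‖ ^ 2) ∧
      ∃ f h, f ≠ 0 ∧ Γ.IsWeakDeriv f h ∧ Γ.IsCKLaplacian f (-((lam : ℂ) • f)) := by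
  obtain ⟨T, hT, hTw⟩ := Γ.exists_compact_primitive
  have : CompleteSpace Γ.derivSubspace := Γ.isClosed_derivSubspace.completeSpace_coe
  set P : L2 E →L[ℂ] L2 E := Γ.derivSubspace.starProjection
  set Q : L2 E →L[ℂ] L2 E := ContinuousLinearMap.id ℂ _ - equilibriumL
  have hQ : ∀ f, Q f = f - equilibrium f := fun f => by
    rw [← equilibriumL_apply]; rfl
  -- Project to admissible derivatives, integrate, subtract the mean. The choice of constants made
  -- by `T` is undone by `Q`, so `A k'` is $k - \bar k$ for every admissible `k`.
  set A : L2 E →L[ℂ] L2 E := Q ∘L T ∘L P with hAdef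
  have hA : IsCompactOperator A := (hT.comp_clm P).clm_comp Q
  have hAP : ∀ h ∈ Γ.derivSubspace, A h = T h - equilibrium (T h) := fun h hh => by
    change Q (T (P h)) = _
    rw [hQ, Submodule.starProjection_eq_self_iff.2 hh]
  have hweak : ∀ k k', Γ.IsWeakDeriv k k' →
      k' ∈ Γ.derivSubspace ∧ k - equilibrium k = A k' := by
    intro k k' hk
    have hk' : k' ∈ Γ.derivSubspace := mem_derivSubspace.2 hk.exists_integral_eq
    refine ⟨hk', ?_⟩
    obtain ⟨c, hc⟩ := (sub_self k' ▸ hk.sub (hTw k' hk')).eq_smul_oneL2 hΓ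
    rw [hAP k' hk', ← hQ, ← hQ, ← sub_eq_zero, ← map_sub, hc, map_smul, hQ, equilibrium_oneL2,
      sub_self, smul_zero]
  have hA0 : A ≠ 0 := by
    intro h0
    obtain ⟨h, hh, hne⟩ := exists_primitive_not_const (E := E)
    have := (hweak _ h (isWeakDeriv_primitive (φ := 0) (a := 0) (by simp) (by simp [hh]))).2
    rw [h0, zero_apply, sub_eq_zero, equilibrium_eq] at this
    exact hne _ this
  have hApos : 0 < ‖A‖ := norm_pos_iff.2 hA0
  refine ⟨(‖A‖ ^ 2)⁻¹, by positivity, fun k k' hk => ?_, ?_⟩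
  · rw [(hweak k k' hk).2, inv_mul_le_iff₀ (by positivity), ← mul_pow]
    gcongr
    exact A.le_opNorm _
  obtain ⟨f, hf0, hf⟩ := exists_eigenvector_comp_adjoint hA hA0
  set m : ℂ := ((‖A‖ ^ 2 : ℝ) : ℂ) with hm
  have hm0 : m ≠ 0 := by
    rw [hm]
    exact_mod_cast (by positivity : ‖A‖ ^ 2 ≠ 0)
  set h := P ((A†) f) with hh
  have hhM : h ∈ Γ.derivSubspace := Submodule.starProjection_apply_mem _ _
  have hAh : A h = m • f := by
    rw [← hf]
    change Q (T (P (P _))) = Q (T (P _))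
    rw [Submodule.starProjection_eq_self_iff.2 hhM]
  have hfw : Γ.IsWeakDeriv f (m⁻¹ • h) := by
    have h1 : f = m⁻¹ • A h := by rw [hAh, inv_smul_smul₀ hm0]
    have h2 := (hTw h hhM).sub_equilibrium.smul m⁻¹
    rwa [← hAP h hhM, ← h1] at h2
  have hf1 : ⟪f, oneL2⟫_ℂ = 0 := by
    rw [← inner_conj_symm, (by rw [hAh, inv_smul_smul₀ hm0] : f = m⁻¹ • A h), inner_smul_right,
      hAP h hhM, inner_oneL2_sub_equilibrium, mul_zero, map_zero]
  refine ⟨f, m⁻¹ • h, hf0, hfw, isCKLaplacian_of_weak hfw fun k k' hk => ?_⟩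
  -- As `f` has mean zero, $\langle f,k\rangle = \langle f,Ak'\rangle = \langle A^\dagger
  -- f,k'\rangle$, and the projection `P` may be inserted because it fixes `k'`.
  have h1 : ⟪f, k⟫_ℂ = ⟪h, k'⟫_ℂ := by
    obtain ⟨hk', hkA⟩ := hweak k k' hk
    have h2 : ⟪f, k⟫_ℂ = ⟪f, A k'⟫_ℂ := by
      rw [← hkA, inner_sub_right, equilibrium_eq, inner_smul_right, hf1, mul_zero, sub_zero]
    rw [h2, ← A.adjoint_inner_left, hh, Submodule.inner_starProjection_left_eq_right,
      Submodule.starProjection_eq_self_iff.2 hk']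
  rw [inner_neg_left, inner_smul_left, inner_smul_left, h1]
  simp [hm]

end Multigraph

/-! ### The gap as lowest eigenvalue and as greatest decay rate. -/

/-- Exponential decay from a differential inequality that holds on the open half line. -/
theorem norm_le_exp_mul_of_re_inner_le {H : Type*} [NormedAddCommGroup H] [InnerProductSpace ℂ H]
    [NormedSpace ℝ H] [IsScalarTower ℝ ℂ H] {w w' : ℝ → H} {lam : ℝ}
    (hc : ContinuousOn w (Ici 0)) (hd : ∀ t, 0 < t → HasDerivAt w (w' t) t)
    (hw : ∀ t, 0 < t → (⟪w' t, w t⟫_ℂ).re ≤ -lam * ‖w t‖ ^ 2) {t : ℝ} (ht : 0 ≤ t) :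
    ‖w t‖ ≤ Real.exp (-lam * t) * ‖w 0‖ := by
  have hder : ∀ s, 0 < s → HasDerivAt (fun s => Real.exp (2 * lam * s) * ‖w s‖ ^ 2)
      (Real.exp (2 * lam * s) * (2 * lam) * ‖w s‖ ^ 2 +
        Real.exp (2 * lam * s) * (2 * (⟪w' s, w s⟫_ℂ).re)) s := by
    intro s hs
    have h1 : HasDerivAt (fun s => ‖w s‖ ^ 2) (2 * (⟪w' s, w s⟫_ℂ).re) s := by
      have h2 := Complex.reCLM.hasFDerivAt.comp_hasDerivAt s ((hd s hs).inner ℂ (hd s hs))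
      have h3 : (Complex.reCLM ∘ fun s => ⟪w s, w s⟫_ℂ) = fun s => ‖w s‖ ^ 2 := by
        funext s
        rw [Function.comp_apply, inner_self_eq_norm_sq_to_K]
        simp [← Complex.ofReal_pow]
      rw [h3] at h2
      refine h2.congr_deriv ?_
      rw [map_add, Complex.reCLM_apply, Complex.reCLM_apply, ← inner_conj_symm (w s) (w' s),
        Complex.conj_re]
      ring
    have h4 : HasDerivAt (fun s => Real.exp (2 * lam * s)) (Real.exp (2 * lam * s) * (2 * lam)) s := by
      simpa using ((hasDerivAt_id s).const_mul (2 * lam)).exp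
    exact h4.mul h1
  -- Continuity at 0 and differentiability in the interior suffice, so the initial value need not
  -- lie in the domain.
  have hanti : AntitoneOn (fun s => Real.exp (2 * lam * s) * ‖w s‖ ^ 2) (Ici 0) := by
    refine antitoneOn_of_deriv_nonpos (convex_Ici 0) ?_ ?_ ?_
    · exact ContinuousOn.mul (by fun_prop) (hc.norm.pow 2)
    · rw [interior_Ici]
      exact fun s hs => (hder s hs).differentiableAt.differentiableWithinAt
    · rw [interior_Ici]
      intro s hs
      rw [(hder s hs).deriv]
      have := mul_le_mul_of_nonneg_left (hw s hs) (Real.exp_pos (2 * lam * s)).le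
      linarith
  have h1 := hanti (mem_Ici.2 (le_refl (0 : ℝ))) ht ht
  simp only [mul_zero, Real.exp_zero, one_mul] at h1
  refine le_of_sq_le_sq ?_ (by positivity)
  have h2 : Real.exp (-lam * t) ^ 2 * Real.exp (2 * lam * t) = 1 := by
    rw [← Real.exp_nat_mul, ← Real.exp_add]
    simp
    ring
  calc ‖w t‖ ^ 2 = Real.exp (-lam * t) ^ 2 * (Real.exp (2 * lam * t) * ‖w t‖ ^ 2) := by
        rw [← mul_assoc, h2, one_mul]
    _ ≤ Real.exp (-lam * t) ^ 2 * ‖w 0‖ ^ 2 := by gcongr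
    _ = _ := by ring

namespace Multigraph

variable {V E : Type*} [Fintype E] {Γ : Multigraph V E}

theorem IsCKLaplacian.smul {f g : L2 E} (H : Γ.IsCKLaplacian f g) (z : ℂ) :
    Γ.IsCKLaplacian (z • f) (z • g) := by
  obtain ⟨F, F', a, b, b', ⟨φ, hφ⟩, hK⟩ := H
  refine ⟨z • F, z • F', (Lp.coeFn_smul _ _).trans (a.const_smul z), fun x hx => ?_, fun x hx => ?_,
    ⟨z • φ, fun e => by simp [hφ e]⟩, fun v => ?_⟩
  · simp only [Pi.smul_apply]
    rw [b x hx, smul_add, intervalIntegral.integral_smul]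
  · rw [intervalIntegral_smul_L2 _ _ hx, Pi.smul_apply, Pi.smul_apply, b' x hx, smul_add]
  · convert congrArg (z * ·) (hK v) using 1
    · rw [Finset.mul_sum]
      refine Finset.sum_congr rfl fun e _ => ?_
      simp [mul_sub, mul_ite]
    · simp

theorem HeatConvergesAtRate.mono {α β : ℝ} (h : Γ.HeatConvergesAtRate β) (hαβ : α ≤ β) :
    Γ.HeatConvergesAtRate α := by
  obtain ⟨C, hC⟩ := h
  refine ⟨max C 0, fun u hu t ht => (hC u hu t ht).trans ?_⟩
  have : -β * t ≤ -α * t := mul_le_mul_of_nonneg_right (by linarith) ht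
  gcongr
  exact le_max_left _ _

theorem norm_sq_deriv_eq {f h : L2 E} {l : ℝ}
    (hk : ∀ k k', Γ.IsWeakDeriv k k' → ⟪-((l : ℂ) • f), k⟫_ℂ = -⟪h, k'⟫_ℂ)
    (hf : Γ.IsWeakDeriv f h) : ‖h‖ ^ 2 = l * ‖f‖ ^ 2 := by
  have h1 := hk f h hf
  rw [inner_neg_left, neg_inj, inner_smul_left, inner_self_eq_norm_sq_to_K,
    inner_self_eq_norm_sq_to_K, Complex.conj_ofReal] at h1
  simp only [Complex.coe_algebraMap, ← Complex.ofReal_pow, ← Complex.ofReal_mul] at h1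
  exact (Complex.ofReal_inj.1 h1).symm

variable [Fintype V]

/-- The constant is a test function with derivative zero. This yields both conservation of the mean
under the heat flow and the vanishing mean of eigenfunctions. -/
theorem IsCKLaplacian.inner_oneL2 {f g : L2 E} (H : Γ.IsCKLaplacian f g) : ⟪oneL2, g⟫_ℂ = 0 := by
  obtain ⟨h, -, hk⟩ := H.exists_isWeakDeriv
  rw [← inner_conj_symm, hk _ _ isWeakDeriv_oneL2]
  simp

theorem IsCKLaplacian.equilibrium_eq_zero {f : L2 E} {l : ℝ} (hl : l ≠ 0)
    (H : Γ.IsCKLaplacian f (-((l : ℂ) • f))) : equilibrium f = 0 := by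
  have h1 := H.inner_oneL2
  rw [inner_neg_right, inner_smul_right, neg_eq_zero, mul_eq_zero] at h1
  rw [equilibrium_eq, h1.resolve_left (by exact_mod_cast hl)]
  simp

section Gap

variable {lam : ℝ}

theorem isLowestNontrivialCKEigenvalue_of_gap (hlam : 0 < lam)
    (hgap : ∀ k k', Γ.IsWeakDeriv k k' → lam * ‖k - equilibrium k‖ ^ 2 ≤ ‖k'‖ ^ 2)
    (hev : Γ.IsCKEigenvalue lam) : Γ.IsLowestNontrivialCKEigenvalue lam := by
  refine ⟨⟨hlam.ne', hev⟩, ?_⟩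
  rintro l ⟨hl, f, hf0, hf⟩
  obtain ⟨h, hw, hk⟩ := hf.exists_isWeakDeriv
  have h1 := hgap f h hw
  rw [hf.equilibrium_eq_zero hl, sub_zero, norm_sq_deriv_eq hk hw] at h1
  exact le_of_mul_le_mul_right h1 (by positivity)

/-- Energy estimate: for $w = u - \bar u$, the weak equation and the gap give $\mathrm{Re}\,\langle
u', w\rangle = -\|w_x\|^2 \le -\lambda\|w\|^2$, with $w_x$ the spatial derivative. -/
theorem heatConvergesAtRate_of_gap [Nonempty E]
    (hgap : ∀ k k', Γ.IsWeakDeriv k k' → lam * ‖k - equilibrium k‖ ^ 2 ≤ ‖k'‖ ^ 2) :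
    Γ.HeatConvergesAtRate lam := by
  refine ⟨1, fun u ⟨hc, hd⟩ t ht => ?_⟩
  choose! g hg using hd
  have hmean : ∀ t, 0 ≤ t → equilibrium (u t) = equilibrium (u 0) := by
    intro t ht
    -- The decay lemma at rate 0, applied to the scalar change of the mean, keeps it at its initial
    -- value 0.
    have h1 := norm_le_exp_mul_of_re_inner_le (H := ℂ) (lam := 0)
      (w := fun s => ⟪oneL2, u s⟫_ℂ - ⟪oneL2, u 0⟫_ℂ) (w' := fun _ => 0)
      ((continuousOn_const.inner hc).sub continuousOn_const) (fun s hs => ?_)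
      (fun s _ => by simp) ht
    · have h2 : ⟪oneL2, u t⟫_ℂ - ⟪oneL2, u 0⟫_ℂ = 0 := norm_le_zero_iff.1 (by simpa using h1)
      rw [equilibrium_eq, equilibrium_eq, sub_eq_zero.1 h2]
    · have h2 := ((hasDerivAt_const s (oneL2 : L2 E)).inner ℂ (hg s hs).1).sub_const
        ⟪oneL2, u 0⟫_ℂ
      rwa [(hg s hs).2.inner_oneL2, inner_zero_left, add_zero] at h2
  rw [one_mul]
  refine norm_le_exp_mul_of_re_inner_le (w := fun s => u s - equilibrium (u 0)) (w' := g)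
    (hc.sub continuousOn_const) (fun s hs => (hg s hs).1.sub_const _) (fun s hs => ?_) ht
  obtain ⟨h, hw, hk⟩ := (hg s hs).2.exists_isWeakDeriv
  have hw' := hw.sub_equilibrium
  have h1 := hgap _ _ hw
  rw [← hmean s hs.le, hk _ _ hw', inner_self_eq_norm_sq_to_K]
  simp only [Complex.coe_algebraMap, ← Complex.ofReal_pow, Complex.neg_re, Complex.ofReal_re]
  linarith

/-- The solution $e^{-\lambda t} f$ started from an eigenfunction has equilibrium zero and decays at
rate exactly $\lambda$, which defeats every constant `C` when $\alpha > \lambda$. -/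
theorem le_of_heatConvergesAtRate {α : ℝ} (hlam : lam ≠ 0) (hev : Γ.IsCKEigenvalue lam)
    (hα : Γ.HeatConvergesAtRate α) : α ≤ lam := by
  obtain ⟨f, hf0, hf⟩ := hev
  obtain ⟨C, hC⟩ := hα
  have hz : equilibrium f = 0 := hf.equilibrium_eq_zero hlam
  let u : ℝ → L2 E := fun t => ((Real.exp (-lam * t) : ℝ) : ℂ) • f
  have hder : ∀ t, HasDerivAt u (((Real.exp (-lam * t) : ℝ) : ℂ) • (-((lam : ℂ) • f))) t := by
    intro t
    have h1 : HasDerivAt (fun t => Real.exp (-lam * t)) (Real.exp (-lam * t) * (-lam)) t := by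
      simpa using ((hasDerivAt_id t).const_mul (-lam)).exp
    refine (h1.ofReal_comp.smul_const f).congr_deriv ?_
    rw [← neg_smul, smul_smul]
    push_cast
    rfl
  have hu : Γ.IsCKHeatSolution u :=
    ⟨fun t _ => (hder t).continuousAt.continuousWithinAt, fun t _ => ⟨_, hder t, hf.smul _⟩⟩
  have hu0 : u 0 = f := by simp [u]
  by_contra! hlt
  obtain ⟨t, ht0, ht⟩ : ∃ t, 0 ≤ t ∧ C < Real.exp ((α - lam) * t) := by
    have h1 : Filter.Tendsto (fun t => Real.exp ((α - lam) * t)) Filter.atTop Filter.atTop :=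
      Real.tendsto_exp_atTop.comp (Filter.tendsto_id.const_mul_atTop (sub_pos.2 hlt))
    exact ((Filter.eventually_ge_atTop 0).and (h1.eventually_gt_atTop C)).exists
  have h1 := hC u hu t ht0
  rw [hu0, hz, sub_zero, sub_zero] at h1
  have h2 : ‖u t‖ = Real.exp (-lam * t) * ‖f‖ := by
    rw [norm_smul, Complex.norm_real, Real.norm_of_nonneg (Real.exp_pos _).le]
  rw [h2] at h1
  have h3 := le_of_mul_le_mul_right h1 (norm_pos_iff.2 hf0)
  have h4 : Real.exp (-lam * t) = Real.exp ((α - lam) * t) * Real.exp (-α * t) := by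
    rw [← Real.exp_add]
    ring_nf
  rw [h4] at h3
  exact absurd (le_of_mul_le_mul_right h3 (Real.exp_pos _)) (not_le.2 ht)

end Gap

end Multigraph

/-! ### Pulling functions back along a contraction of vertices. -/

theorem norm_sq_L2_eq {E : Type*} [Fintype E] {f : L2 E} {F : ℝ → EuclideanSpace ℂ E}
    (hf : f =ᵐ[volume.restrict (Icc (0 : ℝ) 1)] F) (hF : ContinuousOn F (Icc 0 1)) :
    ‖f‖ ^ 2 = ∑ e, ∫ x in (0 : ℝ)..1, ‖F x e‖ ^ 2 := by
  have h1 : ((‖f‖ ^ 2 : ℝ) : ℂ) = ((∫ x in Icc (0 : ℝ) 1, ‖F x‖ ^ 2 : ℝ) : ℂ) := by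
    rw [← integral_complex_ofReal, Complex.ofReal_pow]
    refine (inner_self_eq_norm_sq_to_K (𝕜 := ℂ) f).symm.trans ?_
    rw [L2.inner_def]
    refine integral_congr_ae ?_
    filter_upwards [hf] with x hx
    rw [hx, inner_self_eq_norm_sq_to_K]
    simp
  rw [Complex.ofReal_inj.1 h1, integral_Icc_eq_integral_Ioc,
    ← intervalIntegral.integral_of_le zero_le_one, ← intervalIntegral.integral_finsetSum]
  · simp_rw [EuclideanSpace.norm_sq_eq]
  · intro e _
    refine ContinuousOn.intervalIntegrable ?_
    rw [uIcc_of_le zero_le_one]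
    exact (((EuclideanSpace.proj (𝕜 := ℂ) e).continuous.comp_continuousOn hF).norm.pow 2)

theorem norm_sq_sub_smul_oneL2_eq {E : Type*} [Fintype E] {f : L2 E}
    {F : ℝ → EuclideanSpace ℂ E} (c : ℂ) (hf : f =ᵐ[volume.restrict (Icc (0 : ℝ) 1)] F)
    (hF : ContinuousOn F (Icc 0 1)) :
    ‖f - c • oneL2‖ ^ 2 = ∑ e, ∫ x in (0 : ℝ)..1, ‖F x e - c‖ ^ 2 := by
  let w : EuclideanSpace ℂ E := c • WithLp.toLp 2 fun _ => 1
  have hw : (f - c • oneL2 : L2 E) =ᵐ[volume.restrict (Icc (0 : ℝ) 1)]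
      fun x => F x - w := by
    rw [oneL2, ← constVec_smul]
    filter_upwards [hf, Lp.coeFn_sub f (constVec w),
      Lp.coeFn_const 2 (volume.restrict (Icc (0 : ℝ) 1)) w] with x a b d
    rw [b, Pi.sub_apply, a, d, Function.const_apply]
  have hc : ContinuousOn (fun x => F x - w) (Icc 0 1) := hF.sub (continuousOn_const (c := w))
  rw [norm_sq_L2_eq hw hc]
  simp [w]

namespace Multigraph

variable {V₁ E₁ V₂ E₂ : Type*} [Fintype E₁] [Fintype E₂]
  {Γ₁ : Multigraph V₁ E₁} {Γ₂ : Multigraph V₂ E₂}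

/-- A `C¹` function that is continuous in the vertices of `Γ₂` lifts to `Γ₁` when `Γ₂` is formed
from `Γ₁` by contractions of vertices; it is constant on the discarded edges. -/
theorem IsVertexContraction.exists_lift (hΓ : Γ₁.IsVertexContraction Γ₂)
    {F F' : ℝ → EuclideanSpace ℂ E₂} (hF : ContinuousOn F (Icc 0 1))
    (hF' : ContinuousOn F' (Icc 0 1))
    (hFF' : ∀ x ∈ Icc (0 : ℝ) 1, F x = F 0 + ∫ s in (0 : ℝ)..x, F' s)
    {φ : V₂ → ℂ} (hφ : ∀ e, F 0 e = φ (Γ₂.src e) ∧ F 1 e = φ (Γ₂.tgt e)) :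
    ∃ (i : E₂ → E₁) (G G' : ℝ → EuclideanSpace ℂ E₁), Function.Injective i ∧
      ContinuousOn G (Icc 0 1) ∧ ContinuousOn G' (Icc 0 1) ∧
      (∀ x ∈ Icc (0 : ℝ) 1, G x = G 0 + ∫ s in (0 : ℝ)..x, G' s) ∧
      (∃ ψ : V₁ → ℂ, ∀ e, G 0 e = ψ (Γ₁.src e) ∧ G 1 e = ψ (Γ₁.tgt e)) ∧
      (∀ e c, ∫ x in (0 : ℝ)..1, ‖G x (i e) - c‖ ^ 2 = ∫ x in (0 : ℝ)..1, ‖F x e - c‖ ^ 2) ∧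
      (∀ e, ∫ x in (0 : ℝ)..1, ‖G' x (i e)‖ ^ 2 = ∫ x in (0 : ℝ)..1, ‖F' x e‖ ^ 2) ∧
      ∀ e ∉ range i, ∀ x, G' x e = 0 := by
  classical
  obtain ⟨p, i, hp, hi, hor, hdis⟩ := hΓ
  have hFe : ∀ e, ContinuousOn (fun x => F x e) (Icc 0 1) := fun e =>
    (EuclideanSpace.proj (𝕜 := ℂ) e).continuous.comp_continuousOn hF
  have hFe' : ∀ e, ContinuousOn (fun x => F' x e) (Icc 0 1) := fun e =>
    (EuclideanSpace.proj (𝕜 := ℂ) e).continuous.comp_continuousOn hF'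
  have hint : ∀ e, ∀ x ∈ Icc (0 : ℝ) 1, ∀ y ∈ Icc (0 : ℝ) 1,
      IntervalIntegrable (fun s => F' s e) volume x y := fun e x hx y hy =>
    ((hFe' e).mono (ordConnected_Icc.uIcc_subset hx hy)).intervalIntegrable
  have hprim : ∀ e, ∀ x ∈ Icc (0 : ℝ) 1, F x e = F 0 e + ∫ s in (0 : ℝ)..x, F' s e := by
    intro e x hx
    rw [hFF' x hx, PiLp.add_apply, intervalIntegral_apply]
    exact (hF'.mono (ordConnected_Icc.uIcc_subset (by simp) hx)).intervalIntegrable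
  have hrefl : MapsTo (fun x : ℝ => 1 - x) (Icc 0 1) (Icc 0 1) := fun x hx =>
    ⟨sub_nonneg.2 hx.2, sub_le_self _ hx.1⟩
  -- each edge of `Γ₁` carries a `C¹` function with the prescribed boundary values
  have hedge : ∀ e' : E₁, ∃ a b : ℝ → ℂ, ContinuousOn a (Icc 0 1) ∧ ContinuousOn b (Icc 0 1) ∧
      (∀ x ∈ Icc (0 : ℝ) 1, a x = a 0 + ∫ s in (0 : ℝ)..x, b s) ∧
      a 0 = φ (p (Γ₁.src e')) ∧ a 1 = φ (p (Γ₁.tgt e')) ∧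
      (∀ e, i e = e' →
        (∀ c, ∫ x in (0 : ℝ)..1, ‖a x - c‖ ^ 2 = ∫ x in (0 : ℝ)..1, ‖F x e - c‖ ^ 2) ∧
        ∫ x in (0 : ℝ)..1, ‖b x‖ ^ 2 = ∫ x in (0 : ℝ)..1, ‖F' x e‖ ^ 2) ∧
      (e' ∉ range i → ∀ x, b x = 0) := by
    intro e'
    by_cases he' : e' ∈ range i
    · obtain ⟨e, rfl⟩ := he'
      rcases hor e with ⟨h1, h2⟩ | ⟨h1, h2⟩
      · refine ⟨fun x => F x e, fun x => F' x e, hFe e, hFe' e, hprim e, by simp [(hφ e).1, h1],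
          by simp [(hφ e).2, h2], fun d hd => ?_, fun h => (h (mem_range_self e)).elim⟩
        rw [hi hd]
        exact ⟨fun _ => rfl, rfl⟩
      -- Reversed edge: reflection swaps the end values and flips the sign of the derivative,
      -- leaving both integrals unchanged.
      · refine ⟨fun x => F (1 - x) e, fun x => -F' (1 - x) e,
          (hFe e).comp (by fun_prop) hrefl, ((hFe' e).comp (by fun_prop) hrefl).neg,
          fun x hx => ?_, by simp [(hφ e).2, h2], by simp [(hφ e).1, h1], fun d hd => ?_,
          fun h => (h (mem_range_self e)).elim⟩
        · simp only [sub_zero]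
          rw [intervalIntegral.integral_neg,
            intervalIntegral.integral_comp_sub_left (fun s => F' s e), sub_zero,
            hprim e (1 - x) (hrefl hx), hprim e 1 (by simp),
            ← intervalIntegral.integral_add_adjacent_intervals
              (hint e 0 (by simp) (1 - x) (hrefl hx)) (hint e (1 - x) (hrefl hx) 1 (by simp))]
          ring
        · rw [hi hd]
          refine ⟨fun c => ?_, ?_⟩
          · rw [intervalIntegral.integral_comp_sub_left (fun x => ‖F x e - c‖ ^ 2)]
            simp
          · simp only [norm_neg]
            rw [intervalIntegral.integral_comp_sub_left (fun x => ‖F' x e‖ ^ 2)]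
            simp
    · exact ⟨fun _ => φ (p (Γ₁.src e')), fun _ => 0, continuousOn_const, continuousOn_const,
        by simp, rfl, by rw [(hdis e' he').2], fun e he => (he' ⟨e, he⟩).elim, fun _ _ => rfl⟩
  choose a b ha hb hab h0 h1 hn hz using hedge
  have hcont : ∀ {u : E₁ → ℝ → ℂ}, (∀ e, ContinuousOn (u e) (Icc 0 1)) →
      ContinuousOn (fun x => (WithLp.toLp 2 fun e => u e x : EuclideanSpace ℂ E₁)) (Icc 0 1) :=
    fun hu => (PiLp.continuous_toLp 2 _).comp_continuousOn (continuousOn_pi.2 hu)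
  refine ⟨i, fun x => WithLp.toLp 2 fun e => a e x, fun x => WithLp.toLp 2 fun e => b e x, hi,
    hcont ha, hcont hb, fun x hx => ?_, ⟨φ ∘ p, fun e => ⟨h0 e, h1 e⟩⟩,
    fun e => (hn (i e) e rfl).1, fun e => (hn (i e) e rfl).2, fun e he => hz e he⟩
  ext e
  rw [PiLp.add_apply, intervalIntegral_apply]
  · exact hab e x hx
  · exact ((hcont hb).mono (ordConnected_Icc.uIcc_subset (by simp) hx)).intervalIntegrable

/-- Contractions of vertices do not decrease the spectral gap. -/
theorem IsVertexContraction.gap_le [Fintype V₂] (hΓ : Γ₁.IsVertexContraction Γ₂) {lam₁ lam₂ : ℝ}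
    (hlam₁ : 0 < lam₁) (hlam₂ : lam₂ ≠ 0)
    (hgap : ∀ k k', Γ₁.IsWeakDeriv k k' → lam₁ * ‖k - equilibrium k‖ ^ 2 ≤ ‖k'‖ ^ 2)
    (hev : Γ₂.IsCKEigenvalue lam₂) : lam₁ ≤ lam₂ := by
  classical
  obtain ⟨f, hf0, hf⟩ := hev
  -- The continuous representative of the derivative makes the eigenfunction $C^1$, as the lift
  -- requires.
  obtain ⟨h, ⟨F', hF', hhF'⟩, hw, hk⟩ := hf.exists_continuousOn_isWeakDeriv
  have hnorm := norm_sq_deriv_eq hk hw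
  obtain ⟨F, hfF, hFh, φ, hφ⟩ := hw
  have hF := continuousOn_of_eq_primitive (integrableOn_L2 h) hFh
  have hFF' : ∀ x ∈ Icc (0 : ℝ) 1, F x = F 0 + ∫ s in (0 : ℝ)..x, F' s := fun x hx => by
    rw [hFh x hx, intervalIntegral_congr_L2 hhF' hx]
  obtain ⟨i, G, G', hi, hG, hG', hGG', hψ, hGF, hGF', hG0⟩ := hΓ.exists_lift hF hF' hFF' hφ
  obtain ⟨g, hg⟩ : ∃ g : L2 E₁, g =ᵐ[volume.restrict (Icc (0 : ℝ) 1)] G :=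
    ⟨_, (memLp_of_continuousOn hG).coeFn_toLp⟩
  obtain ⟨g', hg'⟩ : ∃ g' : L2 E₁, g' =ᵐ[volume.restrict (Icc (0 : ℝ) 1)] G' :=
    ⟨_, (memLp_of_continuousOn hG').coeFn_toLp⟩
  have h1 := hgap g g' ⟨G, hg, fun x hx => by
    rw [hGG' x hx, intervalIntegral_congr_L2 hg' hx], hψ⟩
  have h2 : ‖g'‖ ^ 2 = lam₂ * ‖f‖ ^ 2 := by
    rw [← hnorm, norm_sq_L2_eq hg' hG', norm_sq_L2_eq hhF' hF']
    refine (Fintype.sum_of_injective i hi _ _ (fun e he => ?_) fun e => (hGF' e).symm).symm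
    simp [hG0 e he]
  have h3 : ‖f‖ ^ 2 ≤ ‖g - equilibrium g‖ ^ 2 := by
    rw [equilibrium_eq]
    set c := (Fintype.card E₁ : ℂ)⁻¹ * ⟪oneL2, g⟫_ℂ
    -- Here `c` is the mean of the lift `g`, in general not that of `f`. Since `f` is orthogonal to
    -- constants, subtracting any constant can only increase the norm.
    have h4 : ‖f‖ ^ 2 ≤ ‖f - c • oneL2‖ ^ 2 := by
      have h5 : ⟪f, oneL2⟫_ℂ = 0 := by
        have h6 := hf.inner_oneL2
        rw [inner_neg_right, inner_smul_right, neg_eq_zero, mul_eq_zero] at h6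
        rw [← inner_conj_symm, h6.resolve_left (by exact_mod_cast hlam₂), map_zero]
      rw [@norm_sub_sq ℂ, inner_smul_right, h5]
      simp
    refine h4.trans ?_
    rw [norm_sq_sub_smul_oneL2_eq c hfF hF, norm_sq_sub_smul_oneL2_eq c hg hG]
    simp_rw [← hGF _ c]
    rw [← Finset.sum_image (s := Finset.univ) (g := i)
      (f := fun e => ∫ x in (0 : ℝ)..1, ‖G x e - c‖ ^ 2) fun _ _ _ _ h => hi h]
    -- Discarded edges only add nonnegative terms.
    exact Finset.sum_le_sum_of_subset_of_nonneg (Finset.subset_univ _) fun e _ _ =>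
      intervalIntegral.integral_nonneg zero_le_one fun x _ => by positivity
  have h7 : lam₁ * ‖f‖ ^ 2 ≤ lam₂ * ‖f‖ ^ 2 := by
    rw [← h2]
    exact (mul_le_mul_of_nonneg_left h3 hlam₁.le).trans h1
  exact le_of_mul_le_mul_right h7 (by positivity)

end Multigraph

end CKHeat

end

theorem proposition3p4 {V₁ E₁ V₂ E₂ : Type*} [Fintype V₁] [Fintype E₁] [Fintype V₂] [Fintype E₂]
    [Nonempty E₂] (Γ₁ : CKHeat.Multigraph V₁ E₁) (Γ₂ : CKHeat.Multigraph V₂ E₂)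
    (h₁ : Γ₁.Connected) (h₂ : Γ₂.Connected) (h : Γ₁.IsVertexContraction Γ₂) :
    ∃ lam₁ lam₂ : ℝ,
      Γ₁.IsLowestNontrivialCKEigenvalue lam₁ ∧ Γ₂.IsLowestNontrivialCKEigenvalue lam₂ ∧
      0 < lam₁ ∧ lam₁ ≤ lam₂ ∧
      IsGreatest {α : ℝ | Γ₁.HeatConvergesAtRate α} lam₁ ∧
      IsGreatest {α : ℝ | Γ₂.HeatConvergesAtRate α} lam₂ ∧
      (∀ α : ℝ, Γ₁.HeatConvergesAtRate α → Γ₂.HeatConvergesAtRate α) := by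
  -- The map used is the embedding of edges contained in the contraction.
  have : Nonempty E₁ := ‹Nonempty E₂›.map h.choose_spec.choose
  obtain ⟨lam₁, hpos₁, hgap₁, f₁, -, hf₁, -, hev₁⟩ := h₁.exists_spectralGap
  obtain ⟨lam₂, hpos₂, hgap₂, f₂, -, hf₂, -, hev₂⟩ := h₂.exists_spectralGap
  have ev₁ : Γ₁.IsCKEigenvalue lam₁ := ⟨f₁, hf₁, hev₁⟩
  have ev₂ : Γ₂.IsCKEigenvalue lam₂ := ⟨f₂, hf₂, hev₂⟩
  have hle : lam₁ ≤ lam₂ := h.gap_le hpos₁ hpos₂.ne' hgap₁ ev₂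
  have rate₂ := CKHeat.Multigraph.heatConvergesAtRate_of_gap hgap₂
  exact ⟨lam₁, lam₂, CKHeat.Multigraph.isLowestNontrivialCKEigenvalue_of_gap hpos₁ hgap₁ ev₁,
    CKHeat.Multigraph.isLowestNontrivialCKEigenvalue_of_gap hpos₂ hgap₂ ev₂, hpos₁, hle,
    ⟨CKHeat.Multigraph.heatConvergesAtRate_of_gap hgap₁,
      fun _ hα => CKHeat.Multigraph.le_of_heatConvergesAtRate hpos₁.ne' ev₁ hα⟩,
    ⟨rate₂, fun _ hα => CKHeat.Multigraph.le_of_heatConvergesAtRate hpos₂.ne' ev₂ hα⟩,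
    fun _ hα => rate₂.mono
      ((CKHeat.Multigraph.le_of_heatConvergesAtRate hpos₁.ne' ev₁ hα).trans hle)⟩
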